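/- Let $V\subset\mathbb{R}^3$ be a bounded convex open set, and let $\sigma,\sigma^*:V\to\mathbb{R}$ be measurable functions with $0<\sigma_{\min}\le\sigma(\mathbf r)\le\sigma_{\max}$ and $0<\sigma^*_{\min}\le\sigma^*(\mathbf r)\le\sigma^*_{\max}$ for all $\mathbf r\in V$, for some constants $\sigma_{\min},\sigma_{\max},\sigma^*_{\min},\sigma^*_{\max}$. For $\mathbf r,\mathbf r'\in V$ let $\tau(\mathbf r,\mathbf r')$ denote the integral of $\sigma$, with respect to arc length, along the line segment joining $\mathbf r$ and $\mathbf r'$, and let $\mathcal K$ be the integral operator $$(\mathcal K v)(\mathbf r)=\int_V \frac{\exp(-\tau(\mathbf r,\mathbf r'))}{4\pi\,|\mathbf r-\mathbf r'|^2}\,v(\mathbf r')\,\mathrm d\mathbf r'.$$ Let $L^2(V,\sigma)$ be the space of (real- or complex-valued) functions $v$ on $V$ with $\|v\|_{L^2(V,\sigma)}^2=\int_V|v(\mathbf r)|^2\sigma(\mathbf r)\,\mathrm d\mathbf r<\infty$. Then the operator $\mathcal K\sigma^*: g\mapsto \mathcal K(\sigma^* g)$ is a well-defined bounded linear operator on $L^2(V,\sigma)$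 (for every $g\in L^2(V,\sigma)$ the integral defining $\mathcal K(\sigma^* g)(\mathbf r)$ converges absolutely for almost every $\mathbf r\in V$), and its operator norm satisfies $$\|\mathcal K\sigma^*\|_{L^2(V,\sigma)}\;\le\;\left\|\frac{\sigma^*}{\sigma}\right\|_{L^\infty(V)}.$$ -/

import Mathlib

open MeasureTheory
open scoped ENNReal

noncomputable section

namespace Transport

/-- Three-dimensional Euclidean space. -/
abbrev E3 : Type := EuclideanSpace ℝ (Fin 3)

/-- The optical path length `τ(r, r')`: the line integral (with respect to arc length) of `σ` along
the segment from `r` to `r'`, parametrised by `t ↦ r + t (r' - r)`, `0 ≤ t ≤ 1`. -/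
def opticalPath (σ : E3 → ℝ) (r r' : E3) : ℝ :=
  ‖r - r'‖ * ∫ t in (0 : ℝ)..1, σ (r + t • (r' - r))

/-- The kernel `k(r, r') = exp (-τ(r, r')) / (4 π |r - r'|²)`. -/
def kernel (σ : E3 → ℝ) (r r' : E3) : ℝ :=
  Real.exp (-opticalPath σ r r') / (4 * Real.pi * ‖r - r'‖ ^ 2)

/-- The integral operator `(K v)(r) = ∫_V k(r, r') v(r') dr'`. -/
def integralOp {𝕜 : Type*} [RCLike 𝕜] (V : Set E3) (σ : E3 → ℝ) (v : E3 → 𝕜) (r : E3) : 𝕜 :=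
  ∫ r' in V, kernel σ r r' • v r'

/-- The measure `w(r) dr` on `V`. -/
def weightedMeasure (V : Set E3) (w : E3 → ℝ) : Measure E3 :=
  (volume.restrict V).withDensity fun r => ENNReal.ofReal (w r)

/-- The weighted space `L²(V, w)`, with `‖v‖² = ∫_V |v(r)|² w(r) dr`. -/
abbrev WeightedL2 (𝕜 : Type*) [RCLike 𝕜] (V : Set E3) (w : E3 → ℝ) : Type _ :=
  Lp 𝕜 2 (weightedMeasure V w)

end Transport

end

namespace Transport

/-! With respect to `σ dr` the kernel is symmetric and every row has mass at most one. In polar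
coordinates about `r`, the Jacobian `ρ²` cancels `|r - r'|⁻²`, and along each ray `exp(-τ) σ` is
a.e. the derivative of `-exp(-τ)`, so it integrates to at most 1; averaging over directions gives
the mass bound (`lintegral_kernel_mul_le_one`). The Schur test then bounds `g ↦ ∫ k g σ` by 1 on
`L²(σ)`. Since `|σ*| ≤ C σ` a.e. with `C` the essential supremum of `σ*/σ`, the integrand of `K(σ*
g)` is dominated by `C k |g| σ`, which gives both convergence and the norm bound
(`exists_continuousLinearMap_of_schur`).

As `σ` is only a.e. measurable, the argument runs with a Borel version of it; Fubini along segments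
shows that the operator is unchanged (`kernel_congr_ae`). -/

/-- For nonnegative locally integrable `f` with primitive `F x = ∫₀ˣ f`, one has
`∫₀^∞ exp (-F x) f x dx ≤ 1`. -/
theorem lintegral_exp_neg_primitive_mul_le_one {f : ℝ → ℝ} (hf : LocallyIntegrable f volume)
    (h0 : ∀ x, 0 ≤ f x) :
    ∫⁻ x in Set.Ioi (0 : ℝ), ENNReal.ofReal (Real.exp (-∫ t in (0 : ℝ)..x, f t) * f x) ≤ 1 := by
  set F : ℝ → ℝ := fun x => ∫ t in (0 : ℝ)..x, f t with hF
  set g : ℝ → ℝ := fun x => -Real.exp (-F x) with hg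
  have h_int (a b : ℝ) : IntervalIntegrable f volume a b :=
    intervalIntegrable_iff.mpr <|
      (hf.integrableOn_isCompact isCompact_uIcc).mono_set Set.uIoc_subset_uIcc
  have hmono : Monotone F := fun x y hxy => by
    have h := intervalIntegral.integral_add_adjacent_intervals (h_int 0 x) (h_int x y)
    have h' := intervalIntegral.integral_nonneg (μ := volume) hxy fun t _ => h0 t
    simp only [hF]
    linarith
  have hgmono : Monotone g := fun x y hxy => by
    simp only [hg, neg_le_neg_iff, Real.exp_le_exp]
    exact hmono hxy
  have hderiv : ∀ᵐ x, deriv g x = Real.exp (-F x) * f x := by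
    filter_upwards [LocallyIntegrable.ae_hasDerivAt_integral hf] with x hx
    have := ((hx 0).neg.exp).neg.deriv
    simpa [hg] using this
  have hbound (n : ℕ) :
      ∫⁻ x in Set.Ioc (0 : ℝ) n, ENNReal.ofReal (Real.exp (-F x) * f x) ≤ 1 := by
    -- For a monotone function the integral of the derivative is at most the increment; absolute
    -- continuity is not needed.
    have hm : MonotoneOn g (Set.uIcc 0 (n : ℝ)) := hgmono.monotoneOn _
    have hle : ∫ x in (0 : ℝ)..n, deriv g x ≤ 1 := by
      have h := hm.intervalIntegral_deriv_mem_uIcc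
      rw [Set.uIcc_of_le (sub_nonneg.2 (hgmono n.cast_nonneg))] at h
      refine h.2.trans ?_
      have : F 0 = 0 := by simp [hF]
      simp only [hg, this]
      have := Real.exp_pos (-F n)
      simp only [neg_zero, Real.exp_zero]
      linarith
    have hi := hm.intervalIntegrable_deriv
    rw [intervalIntegral.integral_of_le n.cast_nonneg] at hle
    rw [intervalIntegrable_iff_integrableOn_Ioc_of_le n.cast_nonneg] at hi
    rw [lintegral_congr_ae (g := fun x => ENNReal.ofReal (deriv g x))
      ((ae_restrict_of_ae hderiv).mono fun x hx => by simp only [hx])]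
    rw [← ofReal_integral_eq_lintegral_ofReal hi
      ((ae_restrict_of_ae hderiv).mono fun x hx => by
        simp only [hx, Pi.zero_apply]; exact mul_nonneg (Real.exp_pos _).le (h0 x))]
    exact ENNReal.ofReal_le_one.2 hle
  have hU : Set.Ioi (0 : ℝ) = ⋃ n : ℕ, Set.Ioc (0 : ℝ) n := by
    ext x
    simp only [Set.mem_Ioi, Set.mem_iUnion, Set.mem_Ioc]
    exact ⟨fun h => (exists_nat_ge x).imp fun n hn => ⟨h, hn⟩, fun ⟨_, h, _⟩ => h⟩
  rw [hU, setLIntegral_iUnion_of_directed]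
  · exact iSup_le hbound
  · refine Monotone.directed_le fun m n hmn => Set.Ioc_subset_Ioc_right (by exact_mod_cast hmn)

/-- Polar coordinates for the Lebesgue integral on a finite-dimensional space. -/
theorem lintegral_eq_lintegral_sphere_Ioi {E : Type*} [NormedAddCommGroup E] [NormedSpace ℝ E]
    [FiniteDimensional ℝ E] [Nontrivial E] [MeasurableSpace E] [BorelSpace E] (μ : Measure E)
    [μ.IsAddHaarMeasure] {f : E → ℝ≥0∞} (hf : Measurable f) :
    ∫⁻ x, f x ∂μ = ∫⁻ θ, ∫⁻ ρ in Set.Ioi (0 : ℝ),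
      ENNReal.ofReal (ρ ^ (Module.finrank ℝ E - 1)) * f (ρ • (θ : E)) ∂volume ∂μ.toSphere := by
  calc
    ∫⁻ x, f x ∂μ = ∫⁻ x : ({(0)}ᶜ : Set E), f x ∂(μ.comap (↑)) := by
      rw [lintegral_subtype_comap (measurableSet_singleton _).compl f,
        restrict_compl_singleton]
    _ = ∫⁻ p, f ((p.2 : ℝ) • (p.1 : E))
          ∂μ.toSphere.prod (.volumeIoiPow (Module.finrank ℝ E - 1)) := by
      rw [← μ.measurePreserving_homeomorphUnitSphereProd.lintegral_comp_emb
        (Homeomorph.measurableEmbedding _)]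
      refine lintegral_congr fun x => ?_
      have : ‖(x : E)‖ ≠ 0 := norm_ne_zero_iff.2 x.2
      simp [smul_smul, this]
    _ = _ := by
      rw [lintegral_prod _ (by fun_prop)]
      refine lintegral_congr fun θ => ?_
      rw [Measure.volumeIoiPow, lintegral_withDensity_eq_lintegral_mul _ (by fun_prop)
        (by fun_prop), ← lintegral_subtype_comap measurableSet_Ioi]
      rfl

/-! ### The transport kernel: measurability, symmetry, mass -/

theorem measurable_opticalPath {σ : E3 → ℝ} (hσ : Measurable σ) :
    Measurable fun p : E3 × E3 => opticalPath σ p.1 p.2 := by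
  unfold opticalPath
  refine Measurable.mul (by fun_prop) ?_
  simp only [intervalIntegral.integral_of_le zero_le_one]
  have h : StronglyMeasurable fun q : (E3 × E3) × ℝ => σ (q.1.1 + q.2 • (q.1.2 - q.1.1)) :=
    (hσ.comp (by fun_prop)).stronglyMeasurable
  exact h.integral_prod_right.measurable

theorem measurable_kernel {σ : E3 → ℝ} (hσ : Measurable σ) :
    Measurable fun p : E3 × E3 => kernel σ p.1 p.2 := by
  unfold kernel
  have := measurable_opticalPath hσ
  fun_prop

theorem kernel_nonneg (σ : E3 → ℝ) (r r' : E3) : 0 ≤ kernel σ r r' := by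
  unfold kernel
  positivity

theorem opticalPath_comm (σ : E3 → ℝ) (r r' : E3) : opticalPath σ r r' = opticalPath σ r' r := by
  unfold opticalPath
  rw [norm_sub_rev]
  congr 1
  have h := intervalIntegral.integral_comp_sub_left (a := 0) (b := 1)
    (fun t : ℝ => σ (r + t • (r' - r))) 1
  simp only [sub_self, sub_zero] at h
  rw [← h]
  congr 1 with t
  congr 1
  module

theorem kernel_comm (σ : E3 → ℝ) (r r' : E3) : kernel σ r r' = kernel σ r' r := by
  unfold kernel
  rw [opticalPath_comm, norm_sub_rev]

theorem opticalPath_add_smul (σ : E3 → ℝ) (r : E3) {ρ : ℝ} (hρ : 0 ≤ ρ) {θ : E3} (hθ : ‖θ‖ = 1) :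
    opticalPath σ r (r + ρ • θ) = ∫ t in (0 : ℝ)..ρ, σ (r + t • θ) := by
  have h := intervalIntegral.mul_integral_comp_mul_right (a := 0) (b := 1)
    (f := fun t : ℝ => σ (r + t • θ)) ρ
  simp only [zero_mul, one_mul] at h
  rw [← h, opticalPath]
  simp [norm_smul, hθ, abs_of_nonneg hρ, smul_smul]

/-- Every point emits at most unit mass: `∫ k(r, r') σ(r') dr' ≤ 1`. -/
theorem lintegral_kernel_mul_le_one {σ : E3 → ℝ} (hσ : Measurable σ) {M : ℝ}
    (h0 : ∀ x, 0 ≤ σ x) (hM : ∀ x, σ x ≤ M) (r : E3) :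
    ∫⁻ r', ENNReal.ofReal (kernel σ r r') * ENNReal.ofReal (σ r') ≤ 1 := by
  have hk : Measurable fun r' => kernel σ r r' :=
    Measurable.comp (g := fun p : E3 × E3 => kernel σ p.1 p.2) (f := fun r' => (r, r'))
      (measurable_kernel hσ) (by fun_prop)
  rw [← lintegral_add_left_eq_self _ r, lintegral_eq_lintegral_sphere_Ioi _ (by fun_prop)]
  have hin (θ : Metric.sphere (0 : E3) 1) :
      ∫⁻ ρ in Set.Ioi (0 : ℝ), ENNReal.ofReal (ρ ^ (Module.finrank ℝ E3 - 1)) *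
        (ENNReal.ofReal (kernel σ r (r + ρ • (θ : E3))) *
          ENNReal.ofReal (σ (r + ρ • (θ : E3)))) ≤ ENNReal.ofReal (1 / (4 * Real.pi)) := by
    have hθ : ‖(θ : E3)‖ = 1 := by simp
    have hfm : Measurable fun t : ℝ => σ (r + t • (θ : E3)) := by fun_prop
    have hloc : LocallyIntegrable (fun t : ℝ => σ (r + t • (θ : E3))) volume :=
      (locallyIntegrable_const M).mono hfm.aestronglyMeasurable
        (ae_of_all _ fun t => by
          rw [Real.norm_of_nonneg (h0 _)]; exact (hM _).trans (le_abs_self _))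
    calc
      _ = ∫⁻ ρ in Set.Ioi (0 : ℝ), ENNReal.ofReal (1 / (4 * Real.pi)) *
          ENNReal.ofReal (Real.exp (-∫ t in (0 : ℝ)..ρ, σ (r + t • (θ : E3))) *
            σ (r + ρ • (θ : E3))) := by
        refine setLIntegral_congr_fun measurableSet_Ioi fun ρ hρ => ?_
        have hρ : 0 < ρ := hρ
        rw [← ENNReal.ofReal_mul (kernel_nonneg _ _ _), ← ENNReal.ofReal_mul (by positivity),
          ← ENNReal.ofReal_mul (by positivity), kernel, opticalPath_add_smul σ r hρ.le hθ]
        congr 1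
        simp only [sub_add_cancel_left, norm_neg, norm_smul, hθ, finrank_euclideanSpace_fin,
          Real.norm_of_nonneg hρ.le, mul_one]
        field_simp
      _ ≤ _ := by
        rw [lintegral_const_mul' _ _ ENNReal.ofReal_ne_top]
        exact mul_le_of_le_one_right' (lintegral_exp_neg_primitive_mul_le_one hloc fun t => h0 _)
  refine (lintegral_mono hin).trans ?_
  -- The sphere has area 3 · (4π/3) = 4π, cancelling the constant in the kernel.
  rw [lintegral_const, Measure.toSphere_apply_univ, EuclideanSpace.volume_ball_fin_three,
    finrank_euclideanSpace_fin, ← ENNReal.ofReal_natCast, ENNReal.ofReal_one, one_pow, one_mul,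
    ← ENNReal.ofReal_mul (by positivity), ← ENNReal.ofReal_mul (by positivity),
    ENNReal.ofReal_le_one]
  apply le_of_eq
  push_cast
  field_simp

/-! ### Schur test and the operator on weighted `L²` -/

theorem sq_lintegral_le {α : Type*} [MeasurableSpace α] (ν : Measure α) {f : α → ℝ≥0∞}
    (hf : AEMeasurable f ν) : (∫⁻ x, f x ∂ν) ^ 2 ≤ ν Set.univ * ∫⁻ x, f x ^ 2 ∂ν := by
  have h := ENNReal.lintegral_mul_le_Lp_mul_Lq ν (p := 2) (q := 2)
    (Real.HolderConjugate.two_two) (f := fun _ => 1) aemeasurable_const hf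
  simp only [Pi.mul_apply, one_mul, one_pow, lintegral_const, ENNReal.rpow_ofNat] at h
  calc
    _ ≤ (ν Set.univ ^ (1 / 2 : ℝ) * (∫⁻ x, f x ^ 2 ∂ν) ^ (1 / 2 : ℝ)) ^ 2 := by gcongr
    _ = _ := by
      rw [mul_pow, ← ENNReal.rpow_natCast, ← ENNReal.rpow_natCast, ← ENNReal.rpow_mul,
        ← ENNReal.rpow_mul]
      norm_num

/-- The Schur test for a symmetric kernel with marginal mass at most one. -/
theorem lintegral_sq_lintegral_mul_le {α : Type*} [MeasurableSpace α] {μ : Measure α} [SFinite μ]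
    {k : α → α → ℝ≥0∞} (hk : Measurable (Function.uncurry k)) (hsymm : ∀ r r', k r r' = k r' r)
    (h1 : ∀ᵐ r ∂μ, ∫⁻ r', k r r' ∂μ ≤ 1) {f : α → ℝ≥0∞} (hf : AEMeasurable f μ) :
    ∫⁻ r, (∫⁻ r', k r r' * f r' ∂μ) ^ 2 ∂μ ≤ ∫⁻ r, f r ^ 2 ∂μ := by
  have hkr (r : α) : Measurable (k r) := hk.comp measurable_prodMk_left
  have hkf : AEMeasurable (fun p : α × α => k p.1 p.2 * f p.2 ^ 2) (μ.prod μ) :=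
    hk.aemeasurable.mul
      ((hf.pow_const 2).comp_quasiMeasurePreserving Measure.quasiMeasurePreserving_snd)
  calc
    ∫⁻ r, (∫⁻ r', k r r' * f r' ∂μ) ^ 2 ∂μ ≤ ∫⁻ r, ∫⁻ r', k r r' * f r' ^ 2 ∂μ ∂μ := by
      refine lintegral_mono_ae (h1.mono fun r hr => ?_)
      -- Cauchy–Schwarz against the constant 1 for the measure `k(r, ·) μ`, whose mass is at most
      -- one.
      have hac := withDensity_absolutelyContinuous μ (k r)
      have h := sq_lintegral_le (μ.withDensity (k r)) (hf.mono_ac hac)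
      rw [lintegral_withDensity_eq_lintegral_mul₀ (hkr r).aemeasurable hf,
        lintegral_withDensity_eq_lintegral_mul₀ (hkr r).aemeasurable (hf.pow_const 2),
        withDensity_apply _ MeasurableSet.univ, Measure.restrict_univ] at h
      exact h.trans (mul_le_of_le_one_left' hr)
    _ = ∫⁻ r', ∫⁻ r, k r r' * f r' ^ 2 ∂μ ∂μ :=
      lintegral_lintegral_swap hkf
    _ ≤ ∫⁻ r, f r ^ 2 ∂μ := by
      refine lintegral_mono_ae (h1.mono fun r hr => ?_)
      simp only [hsymm _ r]
      rw [lintegral_mul_const _ (hkr r)]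
      exact mul_le_of_le_one_left' hr

/-- Boundedness of `g ↦ ∫ k(r, r') s(r') g(r') dν(r')` on `L²(w ν)` when `k` is symmetric with
`∫ k(r, r') w(r') dν(r') ≤ 1` and `|s| ≤ C w`. -/
theorem exists_continuousLinearMap_of_schur {𝕜 : Type*} [RCLike 𝕜] {α : Type*} [MeasurableSpace α]
    {μ ν : Measure α} [SFinite ν] {w : α → ℝ} (hw : AEMeasurable w ν) (hw0 : ∀ᵐ r ∂ν, 0 < w r)
    (hμ : μ = ν.withDensity fun r => ENNReal.ofReal (w r))
    {k : α → α → ℝ} (hk : Measurable (Function.uncurry k)) (hk0 : ∀ r r', 0 ≤ k r r')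
    (hsymm : ∀ r r', k r r' = k r' r)
    (h1 : ∀ᵐ r ∂ν, ∫⁻ r', ENNReal.ofReal (k r r') * ENNReal.ofReal (w r') ∂ν ≤ 1)
    {s : α → ℝ} (hs : AEMeasurable s ν) {C : ℝ} (hC : 0 ≤ C) (hsC : ∀ᵐ r ∂ν, |s r| ≤ C * w r) :
    ∃ T : Lp 𝕜 2 μ →L[𝕜] Lp 𝕜 2 μ,
      (∀ g, (∀ᵐ r ∂ν, Integrable (fun r' => k r r' • (s r' • g r')) ν) ∧
        T g =ᵐ[ν] fun r => ∫ r', k r r' • (s r' • g r') ∂ν) ∧ ‖T‖ ≤ C := by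
  have : SFinite μ := hμ ▸ inferInstance
  have hwm : AEMeasurable (fun r => ENNReal.ofReal (w r)) ν := hw.ennreal_ofReal
  have hμν : μ ≪ ν := hμ ▸ withDensity_absolutelyContinuous _ _
  -- Positivity of `w` makes `μ` and `ν` mutually absolutely continuous, so a.e. statements pass
  -- both ways.
  have hνμ : ν ≪ μ := hμ ▸ withDensity_absolutelyContinuous' hwm
    (hw0.mono fun r hr => by simpa using hr)
  have hlint {f : α → ℝ≥0∞} (hf : AEMeasurable f ν) :
      ∫⁻ r, f r ∂μ = ∫⁻ r, ENNReal.ofReal (w r) * f r ∂ν := by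
    rw [hμ]
    exact lintegral_withDensity_eq_lintegral_mul₀ hwm hf
  have hkm : Measurable (Function.uncurry fun r r' => ENNReal.ofReal (k r r')) :=
    hk.ennreal_ofReal
  have hkr (r : α) : Measurable (k r) := hk.comp measurable_prodMk_left
  have h1μ : ∀ᵐ r ∂μ, ∫⁻ r', ENNReal.ofReal (k r r') ∂μ ≤ 1 := by
    filter_upwards [hμν.ae_le h1] with r hr
    rw [hlint (hkr r).ennreal_ofReal.aemeasurable]
    simpa only [mul_comm] using hr
  have hschur (g : Lp 𝕜 2 μ) :
      ∫⁻ r, (∫⁻ r', ENNReal.ofReal (k r r') * ‖g r'‖ₑ ∂μ) ^ 2 ∂μ ≤ ∫⁻ r, ‖g r‖ₑ ^ 2 ∂μ :=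
    lintegral_sq_lintegral_mul_le hkm (fun r r' => by rw [hsymm]) h1μ
      (Lp.stronglyMeasurable g).enorm.aemeasurable
  have hgm (g : Lp 𝕜 2 μ) : AEStronglyMeasurable (fun r => s r • g r) ν :=
    hs.aestronglyMeasurable.smul (Lp.stronglyMeasurable g).aestronglyMeasurable
  have hFm (g : Lp 𝕜 2 μ) :
      AEStronglyMeasurable (fun p : α × α => k p.1 p.2 • (s p.2 • g p.2)) (ν.prod ν) :=
    hk.aestronglyMeasurable.smul ((hgm g).comp_quasiMeasurePreserving
      Measure.quasiMeasurePreserving_snd)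
  have hdom (g : Lp 𝕜 2 μ) (r : α) :
      ∫⁻ r', ‖k r r' • (s r' • g r')‖ₑ ∂ν ≤
        ENNReal.ofReal C * ∫⁻ r', ENNReal.ofReal (k r r') * ‖g r'‖ₑ ∂μ := by
    rw [hlint (f := fun r' => ENNReal.ofReal (k r r') * ‖g r'‖ₑ)
        ((hkr r).ennreal_ofReal.aemeasurable.mul (Lp.stronglyMeasurable g).enorm.aemeasurable),
      ← lintegral_const_mul' _ _ ENNReal.ofReal_ne_top]
    refine lintegral_mono_ae (hsC.mono fun r' hr' => ?_)
    have hs' : ‖s r'‖ₑ ≤ ENNReal.ofReal C * ENNReal.ofReal (w r') := by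
      rw [← ENNReal.ofReal_mul hC, ← ofReal_norm]
      exact ENNReal.ofReal_le_ofReal hr'
    rw [enorm_smul, enorm_smul, Real.enorm_of_nonneg (hk0 _ _)]
    calc
      _ ≤ ENNReal.ofReal (k r r') * (ENNReal.ofReal C * ENNReal.ofReal (w r') * ‖g r'‖ₑ) := by
        gcongr
      _ = _ := by ring
  have hL2 (g : Lp 𝕜 2 μ) : eLpNorm g 2 μ ^ 2 = ∫⁻ r, ‖g r‖ₑ ^ 2 ∂μ := by
    simpa using eLpNorm_nnreal_pow_eq_lintegral (f := g) (μ := μ) (p := 2) two_ne_zero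
  have h_int (g : Lp 𝕜 2 μ) : ∀ᵐ r ∂ν, Integrable (fun r' => k r r' • (s r' • g r')) ν := by
    have hfin : ∫⁻ r, (∫⁻ r', ENNReal.ofReal (k r r') * ‖g r'‖ₑ ∂μ) ^ 2 ∂μ ≠ ∞ := by
      refine ne_top_of_le_ne_top ?_ (hschur g)
      rw [← hL2]
      exact ENNReal.pow_ne_top (Lp.eLpNorm_ne_top g)
    have hm : Measurable fun r => ∫⁻ r', ENNReal.ofReal (k r r') * ‖g r'‖ₑ ∂μ :=
      Measurable.lintegral_prod_right' (f := fun p : α × α => ENNReal.ofReal (k p.1 p.2) * ‖g p.2‖ₑ)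
        (hkm.mul ((Lp.stronglyMeasurable g).enorm.comp measurable_snd))
    filter_upwards [hνμ.ae_le (ae_lt_top (hm.pow_const 2) hfin)] with r hr
    refine ⟨(hkr r).aestronglyMeasurable.smul (hgm g), (hdom g r).trans_lt ?_⟩
    refine ENNReal.mul_lt_top ENNReal.ofReal_lt_top ?_
    simpa using hr
  let A (g : Lp 𝕜 2 μ) (r : α) : 𝕜 := ∫ r', k r r' • (s r' • g r') ∂ν
  have hAm (g : Lp 𝕜 2 μ) : AEStronglyMeasurable (A g) μ :=
    (hFm g).integral_prod_right'.mono_ac hμν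
  have hAnorm (g : Lp 𝕜 2 μ) : eLpNorm (A g) 2 μ ≤ ENNReal.ofReal C * eLpNorm g 2 μ := by
    rw [← ENNReal.pow_le_pow_left_iff two_ne_zero, mul_pow, hL2]
    have : eLpNorm (A g) 2 μ ^ 2 = ∫⁻ r, ‖A g r‖ₑ ^ 2 ∂μ := by
      simpa using eLpNorm_nnreal_pow_eq_lintegral (f := A g) (μ := μ) (p := 2) two_ne_zero
    rw [this]
    calc
      _ ≤ ∫⁻ r, ENNReal.ofReal C ^ 2 *
          (∫⁻ r', ENNReal.ofReal (k r r') * ‖g r'‖ₑ ∂μ) ^ 2 ∂μ := by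
        refine lintegral_mono fun r => ?_
        rw [← mul_pow]
        gcongr
        exact (enorm_integral_le_lintegral_enorm _).trans (hdom g r)
      _ ≤ _ := by
        rw [lintegral_const_mul' _ _ (ENNReal.pow_ne_top ENNReal.ofReal_ne_top)]
        exact mul_le_mul_right (hschur g) _
  have hAmem (g : Lp 𝕜 2 μ) : MemLp (A g) 2 μ :=
    ⟨hAm g, (hAnorm g).trans_lt (ENNReal.mul_lt_top ENNReal.ofReal_lt_top (Lp.eLpNorm_lt_top g))⟩
  let T₀ : Lp 𝕜 2 μ →ₗ[𝕜] Lp 𝕜 2 μ :=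
    { toFun := fun g => (hAmem g).toLp (A g)
      map_add' := fun g₁ g₂ => by
        rw [← MemLp.toLp_add, MemLp.toLp_eq_toLp_iff]
        -- Additivity holds only where both integrals converge absolutely; homogeneity below needs
        -- no such restriction.
        filter_upwards [hμν.ae_le (h_int g₁), hμν.ae_le (h_int g₂)] with r h₁ h₂
        rw [Pi.add_apply, ← integral_add h₁ h₂]
        refine integral_congr_ae ((hνμ.ae_eq (Lp.coeFn_add g₁ g₂)).mono fun r' hr' => ?_)
        simp only [hr', Pi.add_apply, smul_add]
      map_smul' := fun c g => by
        rw [RingHom.id_apply, ← MemLp.toLp_const_smul, MemLp.toLp_eq_toLp_iff]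
        refine ae_of_all _ fun r => ?_
        rw [Pi.smul_apply, ← integral_smul]
        refine integral_congr_ae ((hνμ.ae_eq (Lp.coeFn_smul c g)).mono fun r' hr' => ?_)
        simp only [hr', Pi.smul_apply]
        rw [smul_comm (s r') c, smul_comm (k r r') c] }
  have hT₀ (g : Lp 𝕜 2 μ) : ‖T₀ g‖ ≤ C * ‖g‖ := by
    change ‖(hAmem g).toLp (A g)‖ ≤ _
    rw [Lp.norm_toLp, Lp.norm_def, ← ENNReal.toReal_ofReal hC, ← ENNReal.toReal_mul]
    exact ENNReal.toReal_mono
      (ENNReal.mul_ne_top ENNReal.ofReal_ne_top (Lp.eLpNorm_ne_top g))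
      (by simpa [ENNReal.toReal_ofReal hC] using hAnorm g)
  refine ⟨T₀.mkContinuous C hT₀, fun g => ⟨h_int g, ?_⟩, T₀.mkContinuous_norm_le hC hT₀⟩
  exact hνμ.ae_le (hAmem g).coeFn_toLp

/-- On a convex set, changing `σ` on a null set changes `k(r, ·)` only on a null set. -/
theorem kernel_congr_ae {V : Set E3} (hVo : IsOpen V) (hVc : Convex ℝ V) {σ σ' : E3 → ℝ}
    (h : σ =ᵐ[volume.restrict V] σ') {r : E3} (hr : r ∈ V) :
    ∀ᵐ r' ∂(volume.restrict V), kernel σ r r' = kernel σ' r r' := by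
  rw [Filter.EventuallyEq, ae_restrict_iff' hVo.measurableSet] at h
  -- A measurable null hull of the exceptional set, as the Fubini exchange requires.
  set N : Set E3 := toMeasurable volume {x | ¬(x ∈ V → σ x = σ' x)} with hN
  have hN0 : volume N = 0 := by rw [hN, measure_toMeasurable]; exact h
  have hNσ : ∀ x ∈ V, x ∉ N → σ x = σ' x := fun x hx hxN => by
    by_contra hne
    exact hxN (subset_toMeasurable _ _ fun h => hne (h hx))
  have hNm : MeasurableSet N := measurableSet_toMeasurable _ _
  have hline : ∀ᵐ r' : E3, ∀ᵐ t : ℝ, r + t • (r' - r) ∉ N := by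
    have hm : MeasurableSet {p : ℝ × E3 | r + p.1 • (p.2 - r) ∉ N} :=
      (hNm.preimage (f := fun p : ℝ × E3 => r + p.1 • (p.2 - r)) (by fun_prop)).compl
    refine (Measure.ae_ae_comm (p := fun (t : ℝ) (r' : E3) => r + t • (r' - r) ∉ N) hm).1 ?_
    -- For `t ≠ 0` the map `r' ↦ r + t (r' - r)` is a dilation about `r`, so the preimage of `N` is
    -- null. At `t = 0` it is constantly `r`, which may lie in `N`.
    have ht0 : ∀ᵐ t : ℝ, t ≠ 0 := by simp [ae_iff]
    filter_upwards [ht0] with t ht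
    rw [ae_iff]
    simp only [not_not]
    have hpre : {r' : E3 | r + t • (r' - r) ∈ N} =
        (fun x => x + -r) ⁻¹' ((fun x => t • x) ⁻¹' ((fun x => r + x) ⁻¹' N)) := by
      ext; simp [sub_eq_add_neg]
    rw [hpre, measure_preimage_add_right, Measure.addHaar_preimage_smul _ ht,
      measure_preimage_add, hN0, mul_zero]
  rw [ae_restrict_iff' hVo.measurableSet]
  filter_upwards [hline] with r' hr' hr'V
  have : ∫ t in (0 : ℝ)..1, σ (r + t • (r' - r)) = ∫ t in (0 : ℝ)..1, σ' (r + t • (r' - r)) := by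
    refine intervalIntegral.integral_congr_ae (hr'.mono fun t ht htI => hNσ _ ?_ ht)
    rw [Set.uIoc_of_le zero_le_one] at htI
    -- Convexity keeps the segment in `V`, where `σ` and `σ'` agree off `N`.
    exact hVc.add_smul_sub_mem hr hr'V ⟨htI.1.le, htI.2⟩
  simp only [kernel, opticalPath, this]

end Transport

/-! ### The bound for the transport operator -/

theorem theorem1 {𝕜 : Type*} [RCLike 𝕜]
    (V : Set Transport.E3) (hVo : IsOpen V) (hVc : Convex ℝ V) (hVb : Bornology.IsBounded V)
    (σ : Transport.E3 → ℝ) (hσ : AEMeasurable σ (volume.restrict V))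
    (σmin σmax : ℝ) (hσmin : 0 < σmin) (hσb : ∀ r ∈ V, σmin ≤ σ r ∧ σ r ≤ σmax)
    (σs : Transport.E3 → ℝ) (hσs : AEMeasurable σs (volume.restrict V))
    (σsmin σsmax : ℝ) (hσsmin : 0 < σsmin) (hσsb : ∀ r ∈ V, σsmin ≤ σs r ∧ σs r ≤ σsmax) :
    ∃ T : Transport.WeightedL2 𝕜 V σ →L[𝕜] Transport.WeightedL2 𝕜 V σ,
      (∀ g : Transport.WeightedL2 𝕜 V σ,
        (∀ᵐ r ∂(volume.restrict V),
          IntegrableOn (fun r' => Transport.kernel σ r r' • (σs r' • g r')) V volume) ∧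
        T g =ᵐ[volume.restrict V] Transport.integralOp V σ (fun r' => σs r' • g r')) ∧
      ‖T‖ ≤ (eLpNorm (fun r => σs r / σ r) ∞ (volume.restrict V)).toReal := by
  have hmem : ∀ᵐ r ∂(volume.restrict V), r ∈ V := ae_restrict_mem hVo.measurableSet
  -- Truncation makes the Borel version nonnegative and bounded on all of space, since the mass
  -- bound integrates along full rays that leave `V`.
  let σ' : Transport.E3 → ℝ := fun r => max 0 (min σmax (hσ.mk σ r))
  have hσ'm : Measurable σ' := measurable_const.max (measurable_const.min hσ.measurable_mk)
  have hσσ' : σ =ᵐ[volume.restrict V] σ' := by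
    filter_upwards [hmem, hσ.ae_eq_mk] with r hr he
    simp only [σ', ← he]
    rw [min_eq_right (hσb r hr).2, max_eq_right (hσmin.le.trans (hσb r hr).1)]
  have hmass : ∀ r, ∫⁻ r' in V, ENNReal.ofReal (Transport.kernel σ' r r') *
      ENNReal.ofReal (σ r') ≤ 1 := fun r => by
    rw [lintegral_congr_ae (g := fun r' => ENNReal.ofReal (Transport.kernel σ' r r') *
      ENNReal.ofReal (σ' r')) (hσσ'.mono fun r' h => by simp only [h])]
    exact (setLIntegral_le_lintegral _ _).trans (Transport.lintegral_kernel_mul_le_one hσ'm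
      (M := max 0 σmax) (fun x => le_max_left _ _)
      (fun x => max_le_max le_rfl (min_le_left _ _)) r)
  -- Finiteness matters because `toReal` sends `∞` to 0.
  have hfin : eLpNorm (fun r => σs r / σ r) ∞ (volume.restrict V) ≠ ∞ := by
    refine (eLpNormEssSup_lt_top_of_ae_bound (C := σsmax / σmin) ?_).ne
    filter_upwards [hmem] with r hr
    obtain ⟨h₁, h₂⟩ := hσb r hr
    obtain ⟨h₃, h₄⟩ := hσsb r hr
    have : 0 < σ r := hσmin.trans_le h₁
    rw [Real.norm_of_nonneg (div_nonneg (hσsmin.le.trans h₃) this.le)]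
    exact div_le_div₀ (hσsmin.le.trans (h₃.trans h₄)) h₄ hσmin h₁
  have hratio : ∀ᵐ r ∂(volume.restrict V),
      |σs r| ≤ (eLpNorm (fun r => σs r / σ r) ∞ (volume.restrict V)).toReal * σ r := by
    filter_upwards [hmem, enorm_ae_le_eLpNormEssSup (fun r => σs r / σ r) (volume.restrict V)]
      with r hr hle
    have hpos : 0 < σ r := hσmin.trans_le (hσb r hr).1
    have h := ENNReal.toReal_mono hfin hle
    rwa [toReal_enorm, Real.norm_eq_abs, abs_div, abs_of_pos hpos, div_le_iff₀ hpos] at h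
  obtain ⟨T, hT, hTn⟩ := Transport.exists_continuousLinearMap_of_schur (𝕜 := 𝕜)
    (μ := Transport.weightedMeasure V σ) (k := Transport.kernel σ') hσ
    (hmem.mono fun r hr => hσmin.trans_le (hσb r hr).1) rfl (Transport.measurable_kernel hσ'm)
    (Transport.kernel_nonneg σ') (Transport.kernel_comm σ') (ae_of_all _ hmass) hσs
    ENNReal.toReal_nonneg hratio
  refine ⟨T, fun g => ⟨?_, ?_⟩, hTn⟩
  · filter_upwards [hmem, (hT g).1] with r hr hi
    exact hi.congr ((Transport.kernel_congr_ae hVo hVc hσσ' hr).mono fun r' h => by simp only [h])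
  · filter_upwards [hmem, (hT g).2] with r hr he
    rw [he, Transport.integralOp]
    exact integral_congr_ae
      ((Transport.kernel_congr_ae hVo hVc hσσ' hr).mono fun r' h => by simp only [h])
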